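/- Let $M$ be a unital complex $C^*$-algebra. Let ${\cal I}_0\subset M$ be a two-sided ideal carrying a norm $\|\cdot\|_{\cal I}$ with $\|XYZ\|_{\cal I}\le \|X\|\,\|Y\|_{\cal I}\,\|Z\|$ for all $X,Z\in M$ and $Y\in{\cal I}_0$, and let ${\cal I}$ be the completion of ${\cal I}_0$ with respect to $\|\cdot\|_{\cal I}$. For $X,Y\in M$ let $L_X,R_Y\in{\cal B}({\cal I})$ be the bounded extensions to ${\cal I}$ of the maps $T\mapsto XT$ and $T\mapsto TY$ on ${\cal I}_0$. Let $X,Y\in M$ be self-adjoint and put $A=L_X+R_Y\in{\cal B}({\cal I})$. For entire functions $F,G$ the quotient $\frac{F}{G}(A)$ stands for $F(A)\,G(A)^{-1}$, where $G(A)^{-1}$ is the inverse in ${\cal B}({\cal I})$; here $\frac{\sinh z}{z}$ denotes the entire function $\sum_{n\ge 0}\frac{z^{2n}}{(2n+1)!}$, so that $\frac{\sinh(sA)}{s\sinh A}$ means $\frac{\sinh(sA)}{sA}\left(\frac{\sinh A}{A}\right)^{-1}$ and $\frac{sA\cosh(rA)}{\sinh(sA)}$ means $\cosh(rA)\left(\frac{\sinh(sA)}{sA}\right)^{-1}$.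 Then, in each of the following cases, the denominator operator $G(A)$ is invertible in ${\cal B}({\cal I})$ and the map is a contraction of ${\cal B}({\cal I})$, i.e. has operator norm at most $1$: (1) $\displaystyle\frac{\sinh(sA)}{s\sinh(A)}$ for $s\in[0,1]$, where the case $s=0$ is understood as $\displaystyle\frac{A}{\sinh(A)}$; (2) $\displaystyle\frac{\cosh(sA)}{\cosh(A)}$ for $s\in[0,1]$; (3) $\displaystyle\frac{\sinh(sA)}{sA\cosh(rA)}$ for real $r,s$ with $0\le s\le r$; in particular $\displaystyle\frac{\tanh(A)}{A}$ is a contraction; (4) $\displaystyle\frac{sA\cosh(rA)}{\sinh(sA)}$ for real $r,s$ with $0\le 2r\le s$. -/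

import Mathlib

/-- A two-sided ideal of a (unital, complex) C⋆-algebra `M`, equipped with a norm of its own such
that `‖X * Y * Z‖_I ≤ ‖X‖ * ‖Y‖_I * ‖Z‖`. In particular this norm is unitarily invariant. -/
structure NormedIdeal (M : Type*) [CStarAlgebra M] where
  /-- the underlying ideal -/
  ideal : Submodule ℂ M
  mul_mem_left : ∀ (X : M) {Y : M}, Y ∈ ideal → X * Y ∈ ideal
  mul_mem_right : ∀ {Y : M} (Z : M), Y ∈ ideal → Y * Z ∈ ideal
  /-- the norm of the ideal -/
  nrm : Seminorm ℂ ideal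
  eq_zero_of_nrm : ∀ Y : ideal, nrm Y = 0 → Y = 0
  nrm_mul_mul_le : ∀ (X : M) (Y : ideal) (Z : M),
    nrm ⟨X * (Y : M) * Z, mul_mem_right Z (mul_mem_left X Y.2)⟩ ≤ ‖X‖ * nrm Y * ‖Z‖

namespace NormedIdeal

variable {M : Type*} [CStarAlgebra M] (J : NormedIdeal M)

/-- The ideal as a type, which carries the norm of the ideal (and not the norm of `M`). -/
def Pre : Type _ := J.ideal

noncomputable instance : AddCommGroup J.Pre := inferInstanceAs (AddCommGroup J.ideal)

noncomputable instance : Module ℂ J.Pre := inferInstanceAs (Module ℂ J.ideal)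

noncomputable instance : Norm J.Pre := ⟨fun Y => J.nrm Y⟩

noncomputable instance : NormedAddCommGroup J.Pre :=
  NormedAddCommGroup.ofCore (𝕜 := ℂ)
    { norm_nonneg := fun Y => apply_nonneg J.nrm Y
      norm_smul := fun c Y => map_smul_eq_mul J.nrm c Y
      norm_triangle := fun Y Z => map_add_le_add J.nrm Y Z
      norm_eq_zero_iff := fun Y =>
        ⟨fun h => J.eq_zero_of_nrm Y h, fun h => by
          rw [h]; exact map_zero J.nrm⟩ }

noncomputable instance : NormedSpace ℂ J.Pre where
  norm_smul_le c Y := (map_smul_eq_mul J.nrm c Y).le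

/-- The completion of the ideal with respect to its norm. -/
abbrev Compl : Type _ := UniformSpace.Completion J.Pre

/-- Left multiplication `T ↦ X * T` on the ideal. -/
noncomputable def preL (X : M) : J.Pre →L[ℂ] J.Pre :=
  LinearMap.mkContinuous
    ({ toFun := fun T : J.ideal => (⟨X * (T : M), J.mul_mem_left X T.2⟩ : J.ideal)
       map_add' := fun S T => Subtype.ext (mul_add X (S : M) (T : M))
       map_smul' := fun c T => Subtype.ext (mul_smul_comm c X (T : M)) } : J.ideal →ₗ[ℂ] J.ideal)
    (‖X‖ * ‖(1 : M)‖) (fun T => by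
      have h := J.nrm_mul_mul_le X T 1
      simp only [mul_one] at h
      calc _ ≤ ‖X‖ * J.nrm T * ‖(1 : M)‖ := h
        _ = ‖X‖ * ‖(1 : M)‖ * J.nrm T := by ring)

/-- Right multiplication `T ↦ T * Y` on the ideal. -/
noncomputable def preR (Y : M) : J.Pre →L[ℂ] J.Pre :=
  LinearMap.mkContinuous
    ({ toFun := fun T : J.ideal => (⟨(T : M) * Y, J.mul_mem_right Y T.2⟩ : J.ideal)
       map_add' := fun S T => Subtype.ext (add_mul (S : M) (T : M) Y)
       map_smul' := fun c T => Subtype.ext (smul_mul_assoc c (T : M) Y) } : J.ideal →ₗ[ℂ] J.ideal)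
    (‖(1 : M)‖ * ‖Y‖) (fun T => by
      have h := J.nrm_mul_mul_le 1 T Y
      simp only [one_mul] at h
      calc _ ≤ ‖(1 : M)‖ * J.nrm T * ‖Y‖ := h
        _ = ‖(1 : M)‖ * ‖Y‖ * J.nrm T := by ring)

/-- The bounded extension of `T ↦ X * T` to the completion. -/
noncomputable def L (X : M) : J.Compl →L[ℂ] J.Compl := (J.preL X).completion

/-- The bounded extension of `T ↦ T * Y` to the completion. -/
noncomputable def R (Y : M) : J.Compl →L[ℂ] J.Compl := (J.preR Y).completion

end NormedIdeal

/-! Entire functions of a bounded operator `A` on a complex Banach space `E`. -/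

section Entire

variable {E : Type*} [NormedAddCommGroup E] [NormedSpace ℂ E]

/-- `sinh A = (e^A - e^{-A}) / 2` -/
noncomputable def opSinh (A : E →L[ℂ] E) : E →L[ℂ] E :=
  (1 / 2 : ℂ) • (NormedSpace.exp A - NormedSpace.exp (-A))

/-- `cosh A = (e^A + e^{-A}) / 2` -/
noncomputable def opCosh (A : E →L[ℂ] E) : E →L[ℂ] E :=
  (1 / 2 : ℂ) • (NormedSpace.exp A + NormedSpace.exp (-A))

/-- `(sinh z / z)(A) = ∑ A ^ (2 n) / (2 n + 1)!`, the value at `A` of the entire function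
`sinh z / z` (equal to `1` at `z = 0`). -/
noncomputable def opSinhc (A : E →L[ℂ] E) : E →L[ℂ] E :=
  ∑' n : ℕ, (((2 * n + 1).factorial : ℂ)⁻¹) • A ^ (2 * n)

/-- `A · (sinh z / z)(A) = sinh A`: the power series above is the right quotient. -/
theorem mul_opSinhc [CompleteSpace E] (A : E →L[ℂ] E) : A * opSinhc A = opSinh A := by
  have hp := NormedSpace.exp_series_hasSum_exp' (𝕂 := ℂ) A
  have hm := NormedSpace.exp_series_hasSum_exp' (𝕂 := ℂ) (-A)
  have h := ((hp.sub hm).const_smul (1 / 2 : ℂ))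
  have hodd : Function.Injective (fun n : ℕ => 2 * n + 1) := fun a b hab => by
    simpa using hab
  have h2 := (hodd.hasSum_iff (a := opSinh A) (f := fun n : ℕ =>
      (1 / 2 : ℂ) • (((n.factorial : ℂ)⁻¹) • A ^ n - ((n.factorial : ℂ)⁻¹) • (-A) ^ n))
      (fun n hn => by
        have he : Even n := by
          by_contra hne
          obtain ⟨k, hk⟩ := Nat.not_even_iff_odd.mp hne
          exact hn ⟨k, hk.symm⟩
        simp [he.neg_pow])).mpr h
  have h3 : HasSum (fun n : ℕ => (((2 * n + 1).factorial : ℂ)⁻¹) • A ^ (2 * n + 1)) (opSinh A) := by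
    refine h2.congr_fun ?_
    intro n
    simp only [Function.comp_apply, (odd_two_mul_add_one n).neg_pow, smul_neg, sub_neg_eq_add,
      ← add_smul, smul_smul]
    congr 1
    ring
  have hs : Summable (fun n : ℕ => (((2 * n + 1).factorial : ℂ)⁻¹) • A ^ (2 * n)) := by
    have hb : Summable (fun n : ℕ => ‖A‖ ^ (2 * n) / ((2 * n).factorial : ℝ)) :=
      (Real.summable_pow_div_factorial ‖A‖).comp_injective
        (fun a b hab => by simpa using hab : Function.Injective (fun n : ℕ => 2 * n))
    refine Summable.of_norm_bounded_eventually_nat hb ?_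
    filter_upwards [Filter.eventually_ge_atTop 1] with n hn
    rw [norm_smul, norm_inv, Complex.norm_natCast, div_eq_inv_mul]
    gcongr
    · exact Nat.le_succ _
    · exact norm_pow_le' A (by omega)
  have h4 := hs.hasSum.mul_left A
  refine h4.unique ?_
  refine h3.congr_fun fun n => ?_
  rw [mul_smul_comm, ← pow_succ']

/-- The quotient `F(A) G(A)⁻¹` of two operators (meaningful when the second one is invertible in
the algebra of bounded operators, which is part of the next definition). -/
noncomputable def opQuot (F G : E →L[ℂ] E) : E →L[ℂ] E := F * Ring.inverse G

/-- The operator `G` is boundedly invertible and `F G⁻¹` is a contraction. -/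
def IsContractiveQuotient (F G : E →L[ℂ] E) : Prop := IsUnit G ∧ ‖opQuot F G‖ ≤ 1

end Entire

/-! The operator `A = L_X + R_Y` behaves like a self-adjoint operator although the completed ideal
is only a Banach space: `‖1 + i h A‖ ≤ 1 + O(h²)` for real `h`, by the C⋆-identity in `M`
(`isNormHermitian_L_add_R`). This makes every `1 + i c A` with `c` real invertible and
norm-nondecreasing, hence also `1 + a A² = (1 + i√a A)(1 - i√a A)` for `a ≥ 0`. For `0 ≤ b ≤ a` the
operator `1 + b A²` is a convex combination of `1 + a A²` and `1`, so `‖(1 + b A²) v‖ ≤ ‖(1 + a A²)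
v‖`.

By Euler, `sinh z / z` and `cosh z` are products of factors `1 + a_n z²` with `a_n ≥ 0`. Each
quotient in the theorem compares two such products, the rates of the numerator being dominated one
by one by those of the denominator. The finite products converge in operator norm
(`tendsto_opEval_prodPoly`), and the comparison and invertibility survive the limit
(`IsNormHermitian.isContractiveQuotient`). -/

open Filter Topology Polynomial Finset

/-! ### Infinite products with nonnegative rates in a Banach algebra. -/

/-- The polynomial `∏ (1 + a n * X)` over `n < N`. -/
noncomputable def prodPoly (a : ℕ → ℝ) (N : ℕ) : ℝ[X] :=
  ∏ n ∈ range N, (1 + C (a n) * X)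

theorem prodPoly_succ (a : ℕ → ℝ) (N : ℕ) :
    prodPoly a (N + 1) = prodPoly a N * (1 + C (a N) * X) := prod_range_succ _ _

theorem coeff_prodPoly_nonneg {a : ℕ → ℝ} (ha : ∀ n, 0 ≤ a n) (N k : ℕ) :
    0 ≤ (prodPoly a N).coeff k := by
  induction N generalizing k with
  | zero => simp only [prodPoly, range_zero, prod_empty, coeff_one]; split_ifs <;> norm_num
  | succ N ih =>
    rw [prodPoly_succ, mul_add, mul_one, coeff_add, mul_left_comm, coeff_C_mul]
    cases k with
    | zero => simpa using ih 0
    | succ k =>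
      rw [coeff_mul_X]
      exact add_nonneg (ih _) (mul_nonneg (ha N) (ih k))

theorem monotone_coeff_prodPoly {a : ℕ → ℝ} (ha : ∀ n, 0 ≤ a n) (k : ℕ) :
    Monotone fun N => (prodPoly a N).coeff k := by
  refine monotone_nat_of_le_succ fun N => ?_
  rw [prodPoly_succ, mul_add, mul_one, coeff_add, mul_left_comm, coeff_C_mul]
  cases k with
  | zero => simp
  | succ k =>
    rw [coeff_mul_X]
    exact le_add_of_nonneg_right (mul_nonneg (ha N) (coeff_prodPoly_nonneg ha N k))

theorem eval_prodPoly (a : ℕ → ℝ) (N : ℕ) (x : ℝ) :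
    (prodPoly a N).eval x = ∏ n ∈ range N, (1 + a n * x) := by
  simp [prodPoly, eval_prod]

theorem monotone_eval_prodPoly {a : ℕ → ℝ} (ha : ∀ n, 0 ≤ a n) {x : ℝ} (hx : 0 ≤ x) :
    Monotone fun N => (prodPoly a N).eval x := by
  refine monotone_nat_of_le_succ fun N => ?_
  rw [prodPoly_succ, eval_mul]
  refine le_mul_of_one_le_right ?_ (by simpa using mul_nonneg (ha N) hx)
  rw [eval_prodPoly]
  exact prod_nonneg fun n _ => by have := mul_nonneg (ha n) hx; linarith

theorem sum_coeff_le_eval {p : ℝ[X]} (hp : ∀ k, 0 ≤ p.coeff k) {x : ℝ} (hx : 0 ≤ x)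
    (s : Finset ℕ) : ∑ k ∈ s, p.coeff k * x ^ k ≤ p.eval x := by
  rw [eval_eq_sum, Polynomial.sum]
  calc ∑ k ∈ s, p.coeff k * x ^ k ≤ ∑ k ∈ s ∪ p.support, p.coeff k * x ^ k :=
        sum_le_sum_of_subset_of_nonneg subset_union_left fun k _ _ =>
          mul_nonneg (hp k) (pow_nonneg hx k)
    _ = ∑ k ∈ p.support, p.coeff k * x ^ k :=
        (sum_subset subset_union_right fun k _ hk => by
          rw [notMem_support_iff.1 hk, zero_mul]).symm

/-- The value of a real polynomial in a complex algebra. -/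
noncomputable def opEval {𝔸 : Type*} [NormedRing 𝔸] [NormedAlgebra ℂ 𝔸] (B : 𝔸) (p : ℝ[X]) : 𝔸 :=
  aeval B (p.map Complex.ofRealHom)

theorem hasSum_opEval {𝔸 : Type*} [NormedRing 𝔸] [NormedAlgebra ℂ 𝔸] (B : 𝔸) (p : ℝ[X]) :
    HasSum (fun k => (p.coeff k : ℂ) • B ^ k) (opEval B p) := by
  rw [opEval, aeval_eq_sum_range]
  have h : ∀ k, (p.map Complex.ofRealHom).coeff k = (p.coeff k : ℂ) := fun k => by simp
  simp only [h]
  refine hasSum_sum_of_ne_finset_zero fun k hk => ?_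
  rw [mem_range, not_lt, Nat.succ_le_iff] at hk
  rw [← h, coeff_eq_zero_of_natDegree_lt hk, zero_smul]

theorem opEval_ofReal (p : ℝ[X]) (x : ℝ) : opEval (x : ℂ) p = ((p.eval x : ℝ) : ℂ) := by
  simp only [opEval, coe_aeval_eq_eval, eval_map]
  exact (p.hom_eval₂ (RingHom.id ℝ) Complex.ofRealHom x).symm

theorem opEval_one {𝔸 : Type*} [NormedRing 𝔸] [NormedAlgebra ℂ 𝔸] (B : 𝔸) :
    opEval B 1 = 1 := by
  simp [opEval]

theorem opEval_mul {𝔸 : Type*} [NormedRing 𝔸] [NormedAlgebra ℂ 𝔸] (B : 𝔸) (p q : ℝ[X]) :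
    opEval B (p * q) = opEval B p * opEval B q := by
  simp [opEval]

theorem opEval_prodPoly_zero {𝔸 : Type*} [NormedRing 𝔸] [NormedAlgebra ℂ 𝔸] (B : 𝔸)
    (a : ℕ → ℝ) : opEval B (prodPoly a 0) = 1 := by
  simp [opEval, prodPoly]

theorem opEval_prodPoly_succ {𝔸 : Type*} [NormedRing 𝔸] [NormedAlgebra ℂ 𝔸] (B : 𝔸)
    (a : ℕ → ℝ) (N : ℕ) :
    opEval B (prodPoly a (N + 1)) = opEval B (prodPoly a N) * (1 + (a N : ℂ) • B) := by
  rw [prodPoly_succ, opEval_mul]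
  simp [opEval, Algebra.smul_def]

theorem commute_opEval {𝔸 : Type*} [NormedRing 𝔸] [NormedAlgebra ℂ 𝔸] (B : 𝔸) (p : ℝ[X])
    (c : ℂ) : Commute (opEval B p) (1 + c • B) := by
  have h : (1 + c • B) = aeval B (1 + C c * X) := by simp [Algebra.smul_def]
  rw [h, opEval]
  rw [Commute, SemiconjBy, ← map_mul, ← map_mul, mul_comm]

/-- Two everywhere convergent power series that agree for positive arguments are equal. -/
theorem coeff_eq_of_hasSum_pos {c d : ℕ → ℝ} {g : ℝ → ℝ}
    (hc : ∀ x, 0 < x → HasSum (fun k => c k * x ^ k) (g x))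
    (hd : ∀ x, 0 < x → HasSum (fun k => d k * x ^ k) (g x)) : c = d := by
  have key : ∀ e : ℕ → ℝ, (∀ x, 0 < x → HasSum (fun k => e k * x ^ k) (g x)) →
      HasFPowerSeriesAt (fun x => ∑' k, e k * x ^ k)
        (FormalMultilinearSeries.ofScalars ℝ e) 0 := by
    intro e he
    rw [hasFPowerSeriesAt_iff]
    refine Eventually.of_forall fun x => ?_
    -- The point `|x| + 1` is positive and dominates `x`, so convergence there also covers zero and
    -- negative arguments.
    have hs : Summable fun k => e k * x ^ k := by
      have h1 := (he (|x| + 1) (by positivity)).summable.abs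
      refine Summable.of_norm_bounded h1 fun k => ?_
      rw [Real.norm_eq_abs, abs_mul, abs_mul, abs_pow, abs_pow]
      have h2 : |x| ≤ |(|x| + 1)| := by
        rw [abs_of_pos (by positivity : (0 : ℝ) < |x| + 1)]
        linarith
      gcongr
    simpa [FormalMultilinearSeries.coeff_ofScalars, mul_comm] using hs.hasSum
  have h1 := key c hc
  have h2 := key d hd
  have hfreq : ∃ᶠ x in 𝓝[≠] (0 : ℝ), (∑' k, c k * x ^ k) = ∑' k, d k * x ^ k := by
    refine Frequently.filter_mono (f := 𝓝[>] (0 : ℝ)) ?_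
      (nhdsWithin_mono _ fun x hx => ne_of_gt hx)
    refine Eventually.frequently ?_
    filter_upwards [self_mem_nhdsWithin] with x hx
    rw [(hc x hx).tsum_eq, (hd x hx).tsum_eq]
  have h3 := (h1.analyticAt.frequently_eq_iff_eventually_eq h2.analyticAt).1 hfreq
  exact FormalMultilinearSeries.ofScalars_series_injective ℝ ℝ
    (h1.eq_formalMultilinearSeries_of_eventually h2 h3)

/-- Dominated convergence for values of polynomials with nonnegative coefficients. -/
theorem tendsto_opEval_of_tendsto_coeff {p : ℕ → ℝ[X]} {d : ℕ → ℝ}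
    (hp : ∀ N k, 0 ≤ (p N).coeff k) (hpd : ∀ N k, (p N).coeff k ≤ d k)
    (hlim : ∀ k, Tendsto (fun N => (p N).coeff k) atTop (𝓝 (d k)))
    (hsum : ∀ x, 0 ≤ x → Summable fun k => d k * x ^ k)
    {𝔸 : Type*} [NormedRing 𝔸] [NormedAlgebra ℂ 𝔸] [CompleteSpace 𝔸] (B : 𝔸) :
    (Summable fun k => (d k : ℂ) • B ^ k) ∧
      Tendsto (fun N => opEval B (p N)) atTop (𝓝 (∑' k, (d k : ℂ) • B ^ k)) := by
  -- Nothing fixes `‖1‖` in `𝔸`, so the constant must cover `k = 0`.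
  have hpow : ∀ k, ‖B ^ k‖ ≤ (1 + ‖(1 : 𝔸)‖) * ‖B‖ ^ k := by
    intro k
    rcases Nat.eq_zero_or_pos k with rfl | hk
    · simp
    · refine (norm_pow_le' B hk).trans (le_mul_of_one_le_left (by positivity) ?_)
      exact le_add_of_nonneg_right (norm_nonneg _)
  have hb : ∀ (r : ℝ) (k : ℕ), 0 ≤ r → r ≤ d k →
      ‖(r : ℂ) • B ^ k‖ ≤ (1 + ‖(1 : 𝔸)‖) * (d k * ‖B‖ ^ k) := by
    intro r k h0 h1
    rw [norm_smul, Complex.norm_real, Real.norm_of_nonneg h0, mul_left_comm]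
    exact mul_le_mul h1 (hpow k) (norm_nonneg _) (h0.trans h1)
  have hS := (hsum ‖B‖ (norm_nonneg _)).mul_left (1 + ‖(1 : 𝔸)‖)
  have hd0 : ∀ k, 0 ≤ d k := fun k => (hp 0 k).trans (hpd 0 k)
  refine ⟨Summable.of_norm_bounded hS fun k => hb _ k (hd0 k) le_rfl, ?_⟩
  have := tendsto_tsum_of_dominated_convergence (𝓕 := atTop)
    (f := fun N k => (((p N).coeff k : ℝ) : ℂ) • B ^ k) hS
    (fun k => ((Complex.continuous_ofReal.tendsto _).comp (hlim k)).smul_const (B ^ k))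
    (Eventually.of_forall fun N k => hb _ k (hp N k) (hpd N k))
  simpa only [(hasSum_opEval B _).tsum_eq] using this

/-- A product expansion with nonnegative rates, valid for positive real arguments, holds in every
complete complex normed algebra. -/
theorem tendsto_opEval_prodPoly {a c : ℕ → ℝ} {g : ℝ → ℝ} (ha : ∀ n, 0 ≤ a n)
    (hg : ∀ x, 0 < x → Tendsto (fun N => ∏ n ∈ range N, (1 + a n * x)) atTop (𝓝 (g x)))
    (hc : ∀ x, 0 < x → HasSum (fun k => c k * x ^ k) (g x))
    {𝔸 : Type*} [NormedRing 𝔸] [NormedAlgebra ℂ 𝔸] [CompleteSpace 𝔸] (B : 𝔸) :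
    Tendsto (fun N => opEval B (prodPoly a N)) atTop (𝓝 (∑' k, (c k : ℂ) • B ^ k)) := by
  have hle : ∀ x, 0 < x → ∀ N, (prodPoly a N).eval x ≤ g x := fun x hx N =>
    (monotone_eval_prodPoly ha hx.le).ge_of_tendsto
      (by simpa only [eval_prodPoly] using hg x hx) N
  have hsle : ∀ x, 0 < x → ∀ (N : ℕ) (s : Finset ℕ),
      ∑ k ∈ s, (prodPoly a N).coeff k * x ^ k ≤ g x := fun x hx N s =>
    (sum_coeff_le_eval (coeff_prodPoly_nonneg ha N) hx.le s).trans (hle x hx N)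
  have hbdd : ∀ k, BddAbove (Set.range fun N => (prodPoly a N).coeff k) := fun k => by
    refine ⟨g 1, ?_⟩
    rintro _ ⟨N, rfl⟩
    simpa using hsle 1 one_pos N {k}
  set d : ℕ → ℝ := fun k => ⨆ N, (prodPoly a N).coeff k with hd
  have hlim : ∀ k, Tendsto (fun N => (prodPoly a N).coeff k) atTop (𝓝 (d k)) := fun k =>
    tendsto_atTop_ciSup (monotone_coeff_prodPoly ha k) (hbdd k)
  have hcd : ∀ N k, (prodPoly a N).coeff k ≤ d k := fun N k => le_ciSup (hbdd k) N
  have hd0 : ∀ k, 0 ≤ d k := fun k => (coeff_prodPoly_nonneg ha 0 k).trans (hcd 0 k)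
  have hsum : ∀ x, 0 ≤ x → Summable fun k => d k * x ^ k := by
    intro x hx
    have h1 : Summable fun k => d k * (x + 1) ^ k := by
      refine summable_of_sum_le (c := g (x + 1)) (fun k => by have := hd0 k; positivity) fun s => ?_
      exact le_of_tendsto (tendsto_finsetSum _ fun k _ => (hlim k).mul_const _)
        (Eventually.of_forall fun N => hsle (x + 1) (by positivity) N s)
    refine Summable.of_nonneg_of_le (fun k => by have := hd0 k; positivity) (fun k => ?_) h1
    have := hd0 k
    gcongr
    linarith
  -- The limits of the coefficients are identified by applying the convergence result to the scalar
  -- algebra `ℂ`.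
  have hdc : d = c := by
    refine coeff_eq_of_hasSum_pos (g := g) (fun x hx => ?_) hc
    have hx1 := tendsto_opEval_of_tendsto_coeff (coeff_prodPoly_nonneg ha) hcd hlim hsum (x : ℂ)
    have h2 : Tendsto (fun N => opEval (x : ℂ) (prodPoly a N)) atTop (𝓝 (g x : ℂ)) := by
      simp only [opEval_ofReal, eval_prodPoly]
      exact (Complex.continuous_ofReal.tendsto _).comp (hg x hx)
    have h3 := hx1.1.hasSum
    rw [tendsto_nhds_unique hx1.2 h2] at h3
    simp only [smul_eq_mul] at h3
    exact_mod_cast h3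
  rw [← hdc]
  exact (tendsto_opEval_of_tendsto_coeff (coeff_prodPoly_nonneg ha) hcd hlim hsum B).2

/-! ### The product expansions of `sinh` and `cosh` -/

/-- The rates in `sinh z / z = ∏ (1 + z² / ((n + 1)² π²))`. -/
noncomputable def sinhRate (n : ℕ) : ℝ := 1 / ((n + 1) ^ 2 * Real.pi ^ 2)

/-- The rates in `cosh z = ∏ (1 + 4 z² / ((2 n + 1)² π²))`. -/
noncomputable def coshRate (n : ℕ) : ℝ := 4 / ((2 * n + 1) ^ 2 * Real.pi ^ 2)

theorem sinhRate_nonneg (n : ℕ) : 0 ≤ sinhRate n := by unfold sinhRate; positivity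

theorem coshRate_nonneg (n : ℕ) : 0 ≤ coshRate n := by unfold coshRate; positivity

/-- Euler's product for `sin (π z)` at `z = i x / π`. -/
theorem tendsto_prod_sinhRate {x : ℝ} (hx : 0 < x) :
    Tendsto (fun N => ∏ n ∈ range N, (1 + sinhRate n * x ^ 2)) atTop (𝓝 (Real.sinh x / x)) := by
  have hpi : (Real.pi : ℂ) ≠ 0 := Complex.ofReal_ne_zero.2 Real.pi_ne_zero
  have hx0 : (x : ℂ) ≠ 0 := Complex.ofReal_ne_zero.2 hx.ne'
  have h := (Complex.tendsto_euler_sin_prod (x * Complex.I / Real.pi)).div_const (x * Complex.I)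
  have e : (Real.pi : ℂ) * (x * Complex.I / Real.pi) = x * Complex.I := by field_simp
  rw [e, Complex.sin_mul_I, mul_div_mul_right _ _ Complex.I_ne_zero] at h
  have h2 : Tendsto (fun N => ((∏ n ∈ range N, (1 + sinhRate n * x ^ 2) : ℝ) : ℂ)) atTop
      (𝓝 ((Real.sinh x / x : ℝ) : ℂ)) := by
    push_cast
    refine h.congr fun N => ?_
    rw [mul_div_cancel_left₀ _ (mul_ne_zero hx0 Complex.I_ne_zero)]
    refine prod_congr rfl fun n _ => ?_
    have hn : (n : ℂ) + 1 ≠ 0 := by exact_mod_cast n.succ_ne_zero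
    rw [sinhRate, div_pow, mul_pow, Complex.I_sq]
    push_cast
    field_simp
    ring
  have h3 := (Complex.continuous_re.tendsto _).comp h2
  simpa only [Function.comp_def, Complex.ofReal_re] using h3

/-- From `cosh x = sinh (2x) / (2 sinh x)`: among the first `2N` factors at `2x`, those of odd index
cancel the `N` factors at `x`, and those of even index are the factors of `cosh`. -/
theorem tendsto_prod_coshRate {x : ℝ} (hx : 0 < x) :
    Tendsto (fun N => ∏ n ∈ range N, (1 + coshRate n * x ^ 2)) atTop (𝓝 (Real.cosh x)) := by
  have h1 := tendsto_prod_sinhRate hx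
  have h2 := (tendsto_prod_sinhRate (mul_pos two_pos hx)).comp
    (tendsto_id.const_mul_atTop' (two_pos : 0 < 2))
  have hs : 0 < Real.sinh x := Real.sinh_pos_iff.2 hx
  have h3 := h2.div h1 (div_pos hs hx).ne'
  have e : Real.sinh (2 * x) / (2 * x) / (Real.sinh x / x) = Real.cosh x := by
    rw [Real.sinh_two_mul]; field_simp
  rw [e] at h3
  refine h3.congr fun N => ?_
  have hp : ∀ n, 0 < 1 + sinhRate n * x ^ 2 := fun n => by
    have := sinhRate_nonneg n; positivity
  simp only [Pi.div_apply, Function.comp_apply, id]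
  rw [div_eq_iff (prod_pos fun n _ => hp n).ne']
  induction N with
  | zero => simp
  | succ N ih =>
    rw [show 2 * (N + 1) = 2 * N + 1 + 1 by ring, prod_range_succ _ (2 * N + 1),
      prod_range_succ _ (2 * N), ih, prod_range_succ _ N, prod_range_succ _ N]
    have e1 : sinhRate (2 * N) * (2 * x) ^ 2 = coshRate N * x ^ 2 := by
      rw [sinhRate, coshRate]; push_cast; ring
    have e2 : sinhRate (2 * N + 1) * (2 * x) ^ 2 = sinhRate N * x ^ 2 := by
      rw [sinhRate, sinhRate]; push_cast; field_simp; ring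
    rw [e1, e2]
    ring

/-! ### The product expansions at a bounded operator. -/

section

variable {E : Type*} [NormedAddCommGroup E] [NormedSpace ℂ E]

theorem opCosh_eq_tsum [CompleteSpace E] (A : E →L[ℂ] E) :
    opCosh A = ∑' n : ℕ, (((2 * n).factorial : ℂ)⁻¹) • A ^ (2 * n) := by
  have hp := NormedSpace.exp_series_hasSum_exp' (𝕂 := ℂ) A
  have hm := NormedSpace.exp_series_hasSum_exp' (𝕂 := ℂ) (-A)
  have h := (hp.add hm).const_smul (1 / 2 : ℂ)
  have heven : Function.Injective (fun n : ℕ => 2 * n) := fun a b hab => by simpa using hab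
  have h2 := (heven.hasSum_iff (a := opCosh A) (f := fun n : ℕ =>
      (1 / 2 : ℂ) • (((n.factorial : ℂ)⁻¹) • A ^ n + ((n.factorial : ℂ)⁻¹) • (-A) ^ n))
      (fun n hn => by
        have ho : Odd n := by
          by_contra hne
          obtain ⟨k, hk⟩ := Nat.not_odd_iff_even.mp hne
          exact hn ⟨k, by simp only; omega⟩
        simp [ho.neg_pow])).mpr h
  refine (HasSum.tsum_eq (h2.congr_fun fun n => ?_)).symm
  simp only [Function.comp_apply, (even_two_mul n).neg_pow, ← add_smul, smul_smul]
  congr 1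
  ring

/-- Moving the scale `s` into the rates turns all the functions into products in the same operator
`A ^ 2`, ready to be compared factor by factor. -/
theorem opEval_smul_sq (A : E →L[ℂ] E) (s : ℝ) (a : ℕ → ℝ) (N : ℕ) :
    opEval (((s : ℂ) • A) ^ 2) (prodPoly a N) =
      opEval (A ^ 2) (prodPoly (fun n => s ^ 2 * a n) N) := by
  induction N with
  | zero => simp only [opEval_prodPoly_zero]
  | succ N ih =>
    rw [opEval_prodPoly_succ, opEval_prodPoly_succ, ih, _root_.smul_pow, smul_smul]
    push_cast
    rw [mul_comm (a N : ℂ)]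

theorem tendsto_opSinhc [CompleteSpace E] (A : E →L[ℂ] E) (s : ℝ) :
    Tendsto (fun N => opEval (A ^ 2) (prodPoly (fun n => s ^ 2 * sinhRate n) N)) atTop
      (𝓝 (opSinhc ((s : ℂ) • A))) := by
  have h := tendsto_opEval_prodPoly (a := sinhRate) (c := fun k => ((2 * k + 1).factorial : ℝ)⁻¹)
    -- The variable is `x = z²`, in which the even function `sinh z / z` is an entire power series.
    (g := fun x => Real.sinh (√x) / √x) sinhRate_nonneg
    (fun x hx => by
      have := tendsto_prod_sinhRate (Real.sqrt_pos.2 hx)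
      rwa [Real.sq_sqrt hx.le] at this)
    (fun x hx => by
      have hx' := (Real.sqrt_pos.2 hx).ne'
      refine ((Real.hasSum_sinh (√x)).div_const (√x)).congr_fun fun k => ?_
      rw [pow_succ, pow_mul, Real.sq_sqrt hx.le]
      field_simp)
    (((s : ℂ) • A) ^ 2)
  simp only [opEval_smul_sq] at h
  simpa [opSinhc, pow_mul] using h

theorem tendsto_opCosh [CompleteSpace E] (A : E →L[ℂ] E) (s : ℝ) :
    Tendsto (fun N => opEval (A ^ 2) (prodPoly (fun n => s ^ 2 * coshRate n) N)) atTop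
      (𝓝 (opCosh ((s : ℂ) • A))) := by
  have h := tendsto_opEval_prodPoly (a := coshRate) (c := fun k => ((2 * k).factorial : ℝ)⁻¹)
    (g := fun x => Real.cosh (√x)) coshRate_nonneg
    (fun x hx => by
      have := tendsto_prod_coshRate (Real.sqrt_pos.2 hx)
      rwa [Real.sq_sqrt hx.le] at this)
    (fun x hx => by
      refine (Real.hasSum_cosh (√x)).congr_fun fun k => ?_
      rw [pow_mul, Real.sq_sqrt hx.le, div_eq_inv_mul])
    (((s : ℂ) • A) ^ 2)
  simp only [opEval_smul_sq] at h
  rw [opCosh_eq_tsum]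
  simpa [pow_mul] using h

end

/-! ### Hermitian operators on a Banach space and comparison of products. -/

section

variable {E : Type*} [NormedAddCommGroup E] [NormedSpace ℂ E]

/-- An operator is expansive if it does not decrease norms. -/
def IsExpansive (G : E →L[ℂ] E) : Prop := ∀ v, ‖v‖ ≤ ‖G v‖

/-- `‖1 + i h A‖ ≤ 1 + O(h ^ 2)` for real `h`, which says that the operator `A` has real numerical
range. -/
def IsNormHermitian (A : E →L[ℂ] E) : Prop :=
  ∃ K : ℝ, ∀ h : ℝ, |h| ≤ 1 → ‖1 + ((h : ℂ) * Complex.I) • A‖ ≤ 1 + K * h ^ 2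

theorem IsExpansive.norm_inv_le {u : (E →L[ℂ] E)ˣ} (hu : IsExpansive (u : E →L[ℂ] E)) :
    ‖((u⁻¹ : (E →L[ℂ] E)ˣ) : E →L[ℂ] E)‖ ≤ 1 := by
  refine ContinuousLinearMap.opNorm_le_bound _ zero_le_one fun v => ?_
  refine (hu _).trans ?_
  rw [← mul_apply_eq_comp, Units.mul_inv, one_mul, one_apply_eq_self]

theorem tendsto_apply {G : ℕ → E →L[ℂ] E} {G' : E →L[ℂ] E} (hG : Tendsto G atTop (𝓝 G'))
    (v : E) : Tendsto (fun N => G N v) atTop (𝓝 (G' v)) :=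
  ((ContinuousLinearMap.apply ℂ E v).continuous.tendsto _).comp hG

/-- Since `‖G⁻¹‖ ≤ 1`, the Neumann series inverts `1 - G⁻¹ T`. The radius `1` does not depend on
`G`. -/
theorem isUnit_sub_of_isExpansive [CompleteSpace E] {G T : E →L[ℂ] E} (hu : IsUnit G)
    (he : IsExpansive G) (hT : ‖T‖ < 1) : IsUnit (G - T) := by
  obtain ⟨u, rfl⟩ := hu
  have h : (u : E →L[ℂ] E) - T = u * (1 - (u⁻¹ : (E →L[ℂ] E)ˣ) * T) := by
    rw [mul_sub, mul_one, Units.mul_inv_cancel_left]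
  rw [h]
  refine u.isUnit.mul (isUnit_one_sub_of_norm_lt_one ?_)
  refine ((norm_mul_le _ _).trans ?_).trans_lt hT
  exact mul_le_of_le_one_left (norm_nonneg _) he.norm_inv_le

theorem isUnit_of_tendsto_of_isExpansive [CompleteSpace E] {G : ℕ → E →L[ℂ] E}
    {G' : E →L[ℂ] E} (hG : Tendsto G atTop (𝓝 G')) (hu : ∀ N, IsUnit (G N))
    (he : ∀ N, IsExpansive (G N)) : IsUnit G' := by
  obtain ⟨N, hN⟩ := ((Metric.tendsto_nhds.1 hG) 1 one_pos).exists
  have := isUnit_sub_of_isExpansive (hu N) (he N) (T := G N - G') (by rwa [← dist_eq_norm])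
  rwa [sub_sub_cancel] at this

/-- Taking norms in `(1 + h) v = h (1 + i c A) v + (1 - i h c A) v` bounds `(1 + h)‖v‖` by `h ‖(1 +
i c A) v‖ + (1 + K h² c²)‖v‖`. Cancel `‖v‖`, divide by `h` and let `h → 0+`. -/
theorem IsNormHermitian.isExpansive {A : E →L[ℂ] E} (hA : IsNormHermitian A) (c : ℝ) :
    IsExpansive (1 + ((c : ℂ) * Complex.I) • A) := by
  intro v
  obtain ⟨K, hK⟩ := hA
  have hl : Tendsto (fun h : ℝ => ‖(1 + ((c : ℂ) * Complex.I) • A) v‖ + h * (K * c ^ 2 * ‖v‖))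
      (𝓝[>] 0) (𝓝 ‖(1 + ((c : ℂ) * Complex.I) • A) v‖) := by
    refine tendsto_nhdsWithin_of_tendsto_nhds ?_
    have : Continuous fun h : ℝ =>
        ‖(1 + ((c : ℂ) * Complex.I) • A) v‖ + h * (K * c ^ 2 * ‖v‖) := by fun_prop
    simpa using this.tendsto 0
  refine ge_of_tendsto hl ?_
  have hsmall : ∀ᶠ h : ℝ in 𝓝[>] 0, |h * c| ≤ 1 := by
    refine eventually_nhdsWithin_of_eventually_nhds ?_
    have : Tendsto (fun h : ℝ => |h * c|) (𝓝 0) (𝓝 0) := by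
      have : Continuous fun h : ℝ => |h * c| := by fun_prop
      simpa using this.tendsto 0
    exact this.eventually_le_const one_pos
  filter_upwards [hsmall, self_mem_nhdsWithin] with h hc hh
  have hh : 0 < h := hh
  have h1 := hK (-(h * c)) (by rwa [abs_neg])
  have h2 := (ContinuousLinearMap.le_opNorm (1 + (((-(h * c) : ℝ) : ℂ) * Complex.I) • A) v).trans
    (mul_le_mul_of_nonneg_right h1 (norm_nonneg v))
  have e : ((1 + h : ℝ) : ℂ) • v = (h : ℂ) • (1 + ((c : ℂ) * Complex.I) • A) v +
      (1 + (((-(h * c) : ℝ) : ℂ) * Complex.I) • A) v := by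
    simp only [add_apply, one_apply_eq_self,
      smul_apply]
    push_cast
    module
  have h3 := norm_add_le ((h : ℂ) • (1 + ((c : ℂ) * Complex.I) • A) v)
    ((1 + (((-(h * c) : ℝ) : ℂ) * Complex.I) • A) v)
  rw [← e, norm_smul, norm_smul, Complex.norm_real, Complex.norm_real, Real.norm_of_nonneg hh.le,
    Real.norm_of_nonneg (by positivity)] at h3
  refine le_of_mul_le_mul_left ?_ hh
  nlinarith [h2, h3]

/-- For `m > |c| ‖A‖` the operator `1 + i (c/m) A` is invertible by the Neumann series. It is
expansive, so subtracting `(1 - 1/m) · 1`, of norm below `1`, keeps it invertible, and what remains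
is `(1 + i c A) / m`. -/
theorem IsNormHermitian.isUnit [CompleteSpace E] {A : E →L[ℂ] E} (hA : IsNormHermitian A)
    (c : ℝ) : IsUnit (1 + ((c : ℂ) * Complex.I) • A) := by
  obtain ⟨m, hm⟩ := exists_nat_gt (|c| * ‖A‖)
  have hm0 : (0 : ℝ) < m := lt_of_le_of_lt (by positivity) hm
  have hmc : (m : ℂ) ≠ 0 := by exact_mod_cast hm0.ne'
  have hsmall : IsUnit (1 + (((c / m : ℝ) : ℂ) * Complex.I) • A) := by
    have := isUnit_one_sub_of_norm_lt_one (x := -((((c / m : ℝ) : ℂ) * Complex.I) • A)) (by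
      rw [norm_neg, norm_smul, norm_mul, Complex.norm_I, Complex.norm_real, mul_one,
        Real.norm_eq_abs, abs_div, abs_of_pos hm0, div_mul_eq_mul_div, div_lt_one hm0]
      exact hm)
    rwa [sub_neg_eq_add] at this
  have h1 : ‖((1 - 1 / m : ℝ) : ℂ) • (1 : E →L[ℂ] E)‖ < 1 := by
    have hm1 : (1 : ℝ) ≤ m := by exact_mod_cast hm0
    have hle : (1 : ℝ) / m ≤ 1 := (div_le_one hm0).2 hm1
    have hpos : (0 : ℝ) < 1 / m := by positivity
    rw [norm_smul, Complex.norm_real, Real.norm_of_nonneg (by linarith)]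
    have := ContinuousLinearMap.norm_id_le (𝕜 := ℂ) (E := E)
    refine (mul_le_of_le_one_right (by linarith) this).trans_lt (by linarith)
  have h2 := isUnit_sub_of_isExpansive hsmall (hA.isExpansive (c / m)) h1
  have h3 := h2.smul (Units.mk0 (m : ℂ) hmc)
  convert h3 using 1
  rw [Units.smul_mk0]
  push_cast
  rw [add_sub_right_comm, ← one_smul ℂ (1 : E →L[ℂ] E), smul_smul, mul_one, ← sub_smul, smul_add,
    smul_smul, smul_smul]
  congr 2 <;> field_simp
  ring

theorem one_add_smul_sq_eq (A : E →L[ℂ] E) {a : ℝ} (ha : 0 ≤ a) :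
    1 + (a : ℂ) • A ^ 2 = (1 + (((√a : ℝ) : ℂ) * Complex.I) • A) *
      (1 + (((-√a : ℝ) : ℂ) * Complex.I) • A) := by
  have h : (((√a : ℝ) : ℂ) * Complex.I) * (((-√a : ℝ) : ℂ) * Complex.I) = a := by
    have := congrArg Complex.ofReal (Real.mul_self_sqrt ha)
    push_cast at this ⊢
    linear_combination this - (√a : ℂ) ^ 2 * Complex.I_sq
  simp only [mul_add, add_mul, mul_one, one_mul, smul_mul_assoc, mul_smul_comm, ← sq]
  push_cast at h ⊢
  match_scalars <;> first | ring1 | linear_combination -h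

theorem IsNormHermitian.isExpansive_sq {A : E →L[ℂ] E} (hA : IsNormHermitian A) {a : ℝ}
    (ha : 0 ≤ a) : IsExpansive (1 + (a : ℂ) • A ^ 2) := fun v => by
  rw [one_add_smul_sq_eq A ha]
  exact (hA.isExpansive _ v).trans (hA.isExpansive _ _)

theorem IsNormHermitian.isUnit_sq [CompleteSpace E] {A : E →L[ℂ] E} (hA : IsNormHermitian A)
    {a : ℝ} (ha : 0 ≤ a) : IsUnit (1 + (a : ℂ) • A ^ 2) := by
  rw [one_add_smul_sq_eq A ha]
  exact (hA.isUnit _).mul (hA.isUnit _)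

theorem IsNormHermitian.norm_one_add_le {A : E →L[ℂ] E} (hA : IsNormHermitian A) {a b : ℝ}
    (hb : 0 ≤ b) (hab : b ≤ a) (v : E) :
    ‖(1 + (b : ℂ) • A ^ 2 : E →L[ℂ] E) v‖ ≤ ‖(1 + (a : ℂ) • A ^ 2 : E →L[ℂ] E) v‖ := by
  rcases (hb.trans hab).eq_or_lt with h0 | ha
  · rw [show b = a by linarith]
  have hθ0 : 0 ≤ b / a := by positivity
  have hθ1 : 0 ≤ 1 - b / a := sub_nonneg.2 ((div_le_one ha).2 hab)
  -- Convex combination with weight `b / a`; the leftover `‖v‖` is then absorbed by expansiveness.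
  have e : (1 + (b : ℂ) • A ^ 2 : E →L[ℂ] E) v =
      ((b / a : ℝ) : ℂ) • (1 + (a : ℂ) • A ^ 2 : E →L[ℂ] E) v + ((1 - b / a : ℝ) : ℂ) • v := by
    have hac : (a : ℂ) ≠ 0 := Complex.ofReal_ne_zero.2 ha.ne'
    simp only [add_apply, one_apply_eq_self,
      smul_apply, smul_add, smul_smul]
    push_cast
    rw [div_mul_cancel₀ _ hac]
    module
  rw [e]
  refine (norm_add_le _ _).trans ?_
  rw [norm_smul, norm_smul, Complex.norm_real, Complex.norm_real, Real.norm_of_nonneg hθ0,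
    Real.norm_of_nonneg hθ1]
  have := mul_le_mul_of_nonneg_left (hA.isExpansive_sq ha.le v) hθ1
  linarith

theorem IsNormHermitian.isUnit_prod [CompleteSpace E] {A : E →L[ℂ] E} (hA : IsNormHermitian A)
    {a : ℕ → ℝ} (ha : ∀ n, 0 ≤ a n) (N : ℕ) : IsUnit (opEval (A ^ 2) (prodPoly a N)) := by
  induction N with
  | zero => rw [opEval_prodPoly_zero]; exact isUnit_one
  | succ N ih => rw [opEval_prodPoly_succ]; exact ih.mul (hA.isUnit_sq (ha N))

theorem IsNormHermitian.norm_prod_le {A : E →L[ℂ] E} (hA : IsNormHermitian A)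
    {a b : ℕ → ℝ} (hb : ∀ n, 0 ≤ b n) (hab : ∀ n, b n ≤ a n) (N : ℕ) (v : E) :
    ‖opEval (A ^ 2) (prodPoly b N) v‖ ≤ ‖opEval (A ^ 2) (prodPoly a N) v‖ := by
  induction N generalizing v with
  | zero => rw [opEval_prodPoly_zero, opEval_prodPoly_zero]
  | succ N ih =>
    rw [opEval_prodPoly_succ, opEval_prodPoly_succ, mul_apply_eq_comp]
    refine (ih _).trans ?_
    -- Commuting the last factor to the outside lets it be compared at the vector `opEval (A ^ 2)
    -- (prodPoly a N) v`.
    rw [← mul_apply_eq_comp, (commute_opEval (A ^ 2) (prodPoly a N) (b N)).eq,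
      (commute_opEval (A ^ 2) (prodPoly a N) (a N)).eq]
    exact hA.norm_one_add_le (hb N) (hab N) _

theorem IsNormHermitian.isExpansive_prod {A : E →L[ℂ] E} (hA : IsNormHermitian A)
    {a : ℕ → ℝ} (ha : ∀ n, 0 ≤ a n) (N : ℕ) : IsExpansive (opEval (A ^ 2) (prodPoly a N)) := by
  intro v
  have h : opEval (A ^ 2) (prodPoly (fun _ => 0) N) = 1 := by simp [prodPoly, opEval_one]
  simpa only [h, one_apply_eq_self] using
    hA.norm_prod_le (b := fun _ => 0) (fun _ => le_rfl) ha N v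

theorem isContractiveQuotient_of_norm_le {F G : E →L[ℂ] E} (hG : IsUnit G)
    (h : ∀ v, ‖F v‖ ≤ ‖G v‖) : IsContractiveQuotient F G := by
  refine ⟨hG, ContinuousLinearMap.opNorm_le_bound _ zero_le_one fun v => ?_⟩
  refine (h _).trans ?_
  have e : G (Ring.inverse G v) = v := DFunLike.congr_fun (Ring.mul_inverse_cancel G hG) v
  rw [one_mul]
  exact (congrArg norm e).le

/-- Quotients of infinite products with dominated rates are contractive. -/
theorem IsNormHermitian.isContractiveQuotient [CompleteSpace E] {A : E →L[ℂ] E}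
    (hA : IsNormHermitian A) {a b : ℕ → ℝ} (hb : ∀ n, 0 ≤ b n) (hab : ∀ n, b n ≤ a n)
    {F G : E →L[ℂ] E}
    (hF : Tendsto (fun N => opEval (A ^ 2) (prodPoly b N)) atTop (𝓝 F))
    (hG : Tendsto (fun N => opEval (A ^ 2) (prodPoly a N)) atTop (𝓝 G)) :
    IsContractiveQuotient F G := by
  have ha : ∀ n, 0 ≤ a n := fun n => (hb n).trans (hab n)
  refine isContractiveQuotient_of_norm_le
    (isUnit_of_tendsto_of_isExpansive hG (hA.isUnit_prod ha) (hA.isExpansive_prod ha)) fun v => ?_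
  exact le_of_tendsto_of_tendsto' (tendsto_apply hF v).norm (tendsto_apply hG v).norm
    fun N => hA.norm_prod_le hb hab N v

end

/-! ### Left and right multiplication on the completed ideal. -/

theorem norm_one_le_one (M : Type*) [CStarAlgebra M] : ‖(1 : M)‖ ≤ 1 := by
  rcases subsingleton_or_nontrivial M with h | h
  · rw [Subsingleton.elim (1 : M) 0, norm_zero]
    exact zero_le_one
  · exact CStarRing.norm_one.le

namespace NormedIdeal

variable {M : Type*} [CStarAlgebra M] (J : NormedIdeal M)

theorem norm_L_le (X : M) : ‖J.L X‖ ≤ ‖X‖ := by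
  refine ContinuousLinearMap.opNorm_le_bound _ (norm_nonneg X) fun v => ?_
  induction v using UniformSpace.Completion.induction_on with
  | hp => exact isClosed_le (by fun_prop) (by fun_prop)
  | ih T =>
    rw [L, ContinuousLinearMap.completion_apply_coe, UniformSpace.Completion.norm_coe,
      UniformSpace.Completion.norm_coe]
    have h := J.nrm_mul_mul_le X T 1
    have h1 : ‖(1 : M)‖ ≤ 1 := norm_one_le_one M
    simp only [mul_one] at h
    exact h.trans (mul_le_of_le_one_right (mul_nonneg (norm_nonneg _) (norm_nonneg T)) h1)

theorem norm_R_le (Y : M) : ‖J.R Y‖ ≤ ‖Y‖ := by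
  refine ContinuousLinearMap.opNorm_le_bound _ (norm_nonneg Y) fun v => ?_
  induction v using UniformSpace.Completion.induction_on with
  | hp => exact isClosed_le (by fun_prop) (by fun_prop)
  | ih T =>
    rw [R, ContinuousLinearMap.completion_apply_coe, UniformSpace.Completion.norm_coe,
      UniformSpace.Completion.norm_coe]
    have h := J.nrm_mul_mul_le 1 T Y
    have h1 : ‖(1 : M)‖ ≤ 1 := norm_one_le_one M
    simp only [one_mul] at h
    refine h.trans ?_
    rw [mul_comm ‖Y‖]
    exact mul_le_mul_of_nonneg_right (mul_le_of_le_one_left (norm_nonneg T) h1) (norm_nonneg _)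

theorem L_one_add_smul (c : ℂ) (X : M) : J.L (1 + c • X) = 1 + c • J.L X := by
  ext v
  induction v using UniformSpace.Completion.induction_on with
  | hp => exact isClosed_eq (by fun_prop) (by fun_prop)
  | ih T =>
    simp only [L, add_apply, one_apply_eq_self,
      smul_apply, ContinuousLinearMap.completion_apply_coe]
    rw [← UniformSpace.Completion.coe_smul, ← UniformSpace.Completion.coe_add]
    congr 1
    refine Subtype.ext ?_
    change (1 + c • X) * (T : J.ideal).1 = (T : J.ideal).1 + c • (X * (T : J.ideal).1)
    rw [add_mul, one_mul, smul_mul_assoc]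

theorem R_one_add_smul (c : ℂ) (Y : M) : J.R (1 + c • Y) = 1 + c • J.R Y := by
  ext v
  induction v using UniformSpace.Completion.induction_on with
  | hp => exact isClosed_eq (by fun_prop) (by fun_prop)
  | ih T =>
    simp only [R, add_apply, one_apply_eq_self,
      smul_apply, ContinuousLinearMap.completion_apply_coe]
    rw [← UniformSpace.Completion.coe_smul, ← UniformSpace.Completion.coe_add]
    congr 1
    refine Subtype.ext ?_
    change (T : J.ideal).1 * (1 + c • Y) = (T : J.ideal).1 + c • ((T : J.ideal).1 * Y)
    rw [mul_add, mul_one, mul_smul_comm]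

/-- For self-adjoint `X` the C⋆-identity gives `‖1 + i h X‖ ≤ 1 + h ^ 2 ‖X‖ ^ 2`. -/
theorem _root_.IsSelfAdjoint.norm_one_add_I_smul_le {X : M} (hX : IsSelfAdjoint X) (h : ℝ) :
    ‖1 + ((h : ℂ) * Complex.I) • X‖ ≤ 1 + h ^ 2 * ‖X‖ ^ 2 := by
  have h1 : ‖(1 : M)‖ ≤ 1 := norm_one_le_one M
  have e : star (1 + ((h : ℂ) * Complex.I) • X) * (1 + ((h : ℂ) * Complex.I) • X) =
      1 + ((h ^ 2 : ℝ) : ℂ) • (X * X) := by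
    have hs : star ((h : ℂ) * Complex.I) = -((h : ℂ) * Complex.I) := by simp
    rw [star_add, star_one, star_smul, hX.star_eq, hs]
    simp only [mul_add, add_mul, mul_one, one_mul, smul_mul_assoc, mul_smul_comm]
    have h' : -((h : ℂ) * Complex.I) * ((h : ℂ) * Complex.I) = ((h ^ 2 : ℝ) : ℂ) := by
      push_cast
      linear_combination -(h : ℂ) ^ 2 * Complex.I_sq
    push_cast at h' ⊢
    match_scalars <;> first | ring1 | linear_combination h'
  have h2 := CStarRing.norm_star_mul_self (x := 1 + ((h : ℂ) * Complex.I) • X)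
  rw [e] at h2
  have h3 : ‖1 + ((h ^ 2 : ℝ) : ℂ) • (X * X)‖ ≤ 1 + h ^ 2 * ‖X‖ ^ 2 := by
    refine (norm_add_le _ _).trans (add_le_add h1 ?_)
    rw [norm_smul, Complex.norm_real, Real.norm_of_nonneg (sq_nonneg h), sq ‖X‖]
    exact mul_le_mul_of_nonneg_left (norm_mul_le X X) (sq_nonneg h)
  have h4 : 0 ≤ h ^ 2 * ‖X‖ ^ 2 := by positivity
  nlinarith

theorem isNormHermitian_L_add_R {X Y : M} (hX : IsSelfAdjoint X) (hY : IsSelfAdjoint Y) :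
    IsNormHermitian (J.L X + J.R Y) := by
  refine ⟨‖X‖ ^ 2 + ‖Y‖ ^ 2 + ‖X‖ ^ 2 * ‖Y‖ ^ 2 + ‖X‖ * ‖Y‖, fun h hh => ?_⟩
  set c : ℂ := (h : ℂ) * Complex.I with hc
  have hcn : ‖c ^ 2‖ = h ^ 2 := by
    rw [hc, norm_pow, norm_mul, Complex.norm_I, Complex.norm_real, mul_one, Real.norm_eq_abs, sq_abs]
  -- Up to a term of order `h²` the operator factors into two multiplications, each controlled by
  -- the C⋆-identity in `M`.
  have e : 1 + c • (J.L X + J.R Y) =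
      J.L (1 + c • X) * J.R (1 + c • Y) - (c ^ 2) • (J.L X * J.R Y) := by
    rw [L_one_add_smul, R_one_add_smul]
    simp only [mul_add, add_mul, mul_one, one_mul, smul_mul_assoc, mul_smul_comm]
    module
  have h1 : ‖J.L (1 + c • X)‖ ≤ 1 + h ^ 2 * ‖X‖ ^ 2 :=
    (J.norm_L_le _).trans (hX.norm_one_add_I_smul_le h)
  have h2 : ‖J.R (1 + c • Y)‖ ≤ 1 + h ^ 2 * ‖Y‖ ^ 2 :=
    (J.norm_R_le _).trans (hY.norm_one_add_I_smul_le h)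
  have h3 : ‖J.L X * J.R Y‖ ≤ ‖X‖ * ‖Y‖ :=
    (norm_mul_le _ _).trans (mul_le_mul (J.norm_L_le X) (J.norm_R_le Y) (norm_nonneg _)
      (norm_nonneg _))
  have h4 : ‖J.L (1 + c • X) * J.R (1 + c • Y)‖ ≤ (1 + h ^ 2 * ‖X‖ ^ 2) * (1 + h ^ 2 * ‖Y‖ ^ 2) :=
    (norm_mul_le _ _).trans (mul_le_mul h1 h2 (norm_nonneg _) (by positivity))
  have h5 : ‖(c ^ 2) • (J.L X * J.R Y)‖ ≤ h ^ 2 * (‖X‖ * ‖Y‖) := by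
    rw [norm_smul, hcn]
    exact mul_le_mul_of_nonneg_left h3 (sq_nonneg h)
  -- Here `|h| ≤ 1` absorbs the fourth-order term of the product.
  have h6 : h ^ 2 * h ^ 2 ≤ h ^ 2 :=
    mul_le_of_le_one_left (sq_nonneg h) ((sq_le_one_iff_abs_le_one h).2 hh)
  rw [e]
  refine (norm_sub_le _ _).trans ((add_le_add h4 h5).trans ?_)
  have h7 := mul_le_mul_of_nonneg_right h6 (by positivity : 0 ≤ ‖X‖ ^ 2 * ‖Y‖ ^ 2)
  linarith

end NormedIdeal

/-! ### Comparison of the rates and conclusion. -/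

theorem sinhRate_le_coshRate (n : ℕ) : sinhRate n ≤ coshRate n := by
  rw [sinhRate, coshRate, div_le_div_iff₀ (by positivity) (by positivity), one_mul, ← mul_assoc]
  refine mul_le_mul_of_nonneg_right ?_ (sq_nonneg _)
  nlinarith [n.cast_nonneg (α := ℝ)]

/-- Amounts to `n + 1 ≤ 2n + 1`, with equality at `n = 0`. The constant `4 = 2²` is the source of
the condition `2 * r ≤ s`. -/
theorem coshRate_le_four_mul_sinhRate (n : ℕ) : coshRate n ≤ 4 * sinhRate n := by
  rw [sinhRate, coshRate, mul_one_div]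
  have : (0 : ℝ) ≤ n := n.cast_nonneg
  gcongr
  linarith

theorem mainTheorem7 {M : Type*} [CStarAlgebra M] (J : NormedIdeal M) (X Y : M)
    (hX : IsSelfAdjoint X) (hY : IsSelfAdjoint Y)
    (A : J.Compl →L[ℂ] J.Compl) (hA : A = J.L X + J.R Y) :
    -- `sinh (sA) / (s sinh A)`, that is `(sinh (sA) / (sA)) (sinh A / A)⁻¹`
    (∀ s : ℝ, 0 ≤ s → s ≤ 1 → IsContractiveQuotient (opSinhc ((s : ℂ) • A)) (opSinhc A)) ∧
    -- its case `s = 0`, the map `A / sinh A`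
    IsContractiveQuotient 1 (opSinhc A) ∧
    -- `cosh (sA) / cosh A`
    (∀ s : ℝ, 0 ≤ s → s ≤ 1 → IsContractiveQuotient (opCosh ((s : ℂ) • A)) (opCosh A)) ∧
    -- `sinh (sA) / (sA cosh (rA))`
    (∀ s r : ℝ, 0 ≤ s → s ≤ r →
      IsContractiveQuotient (opSinhc ((s : ℂ) • A)) (opCosh ((r : ℂ) • A))) ∧
    -- `tanh A / A`
    IsContractiveQuotient (opSinhc A) (opCosh A) ∧
    -- `sA cosh (rA) / sinh (sA)`
    (∀ s r : ℝ, 0 ≤ r → 2 * r ≤ s →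
      IsContractiveQuotient (opCosh ((r : ℂ) • A)) (opSinhc ((s : ℂ) • A))) := by
  have hH : IsNormHermitian A := hA ▸ J.isNormHermitian_L_add_R hX hY
  have hS : ∀ (s : ℝ) n, 0 ≤ s ^ 2 * sinhRate n := fun s n =>
    mul_nonneg (sq_nonneg s) (sinhRate_nonneg n)
  have hC : ∀ (s : ℝ) n, 0 ≤ s ^ 2 * coshRate n := fun s n =>
    mul_nonneg (sq_nonneg s) (coshRate_nonneg n)
  have hone : ((1 : ℝ) : ℂ) • A = A := by rw [Complex.ofReal_one, one_smul]
  have h1 : ∀ s t : ℝ, 0 ≤ s → s ≤ t →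
      IsContractiveQuotient (opSinhc ((s : ℂ) • A)) (opSinhc ((t : ℂ) • A)) := fun s t hs hst =>
    hH.isContractiveQuotient (hS s)
      (fun n => mul_le_mul_of_nonneg_right (pow_le_pow_left₀ hs hst 2) (sinhRate_nonneg n))
      (tendsto_opSinhc A s) (tendsto_opSinhc A t)
  have h2 : ∀ s t : ℝ, 0 ≤ s → s ≤ t →
      IsContractiveQuotient (opCosh ((s : ℂ) • A)) (opCosh ((t : ℂ) • A)) := fun s t hs hst =>
    hH.isContractiveQuotient (hC s)
      (fun n => mul_le_mul_of_nonneg_right (pow_le_pow_left₀ hs hst 2) (coshRate_nonneg n))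
      (tendsto_opCosh A s) (tendsto_opCosh A t)
  have h3 : ∀ s r : ℝ, 0 ≤ s → s ≤ r →
      IsContractiveQuotient (opSinhc ((s : ℂ) • A)) (opCosh ((r : ℂ) • A)) := fun s r hs hsr =>
    hH.isContractiveQuotient (hS s)
      (fun n => mul_le_mul (pow_le_pow_left₀ hs hsr 2) (sinhRate_le_coshRate n)
        (sinhRate_nonneg n) (sq_nonneg r))
      (tendsto_opSinhc A s) (tendsto_opCosh A r)
  -- At `s = 0` all rates vanish and every partial product is `1`.
  have hzero : opSinhc (((0 : ℝ) : ℂ) • A) = 1 := by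
    refine tendsto_nhds_unique (tendsto_opSinhc A 0) ?_
    simp [prodPoly, opEval_one]
  refine ⟨fun s hs hs1 => ?_, ?_, fun s hs hs1 => ?_, h3, ?_, fun s r hr hrs => ?_⟩
  · simpa only [hone] using h1 s 1 hs hs1
  · simpa only [hone, hzero] using h1 0 1 le_rfl zero_le_one
  · simpa only [hone] using h2 s 1 hs hs1
  · simpa only [hone] using h3 1 1 zero_le_one le_rfl
  · refine hH.isContractiveQuotient (hC r) (fun n => ?_) (tendsto_opCosh A r) (tendsto_opSinhc A s)
    calc r ^ 2 * coshRate n ≤ r ^ 2 * (4 * sinhRate n) :=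
          mul_le_mul_of_nonneg_left (coshRate_le_four_mul_sinhRate n) (sq_nonneg r)
      _ = (2 * r) ^ 2 * sinhRate n := by ring
      _ ≤ s ^ 2 * sinhRate n :=
          mul_le_mul_of_nonneg_right (pow_le_pow_left₀ (by positivity) hrs 2) (sinhRate_nonneg n)
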